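/- Let $E$ and $F$ be real Banach spaces, let $X$ and $Y$ be smooth ($C^\infty$) Banach manifolds without boundary modelled on $E$ and $F$ respectively (no separability or second countability is assumed), and let $\Phi : X \to Y$ be a smooth map such that * $\Phi$ is Fredholm, that is, for every $x \in X$ the differential $D\Phi(x) : T_xX \to T_{\Phi(x)}Y$ is a Fredholm operator (it has finite-dimensional kernel and closed range of finite codimension); and * $\Phi$ is paraproper, that is, there exists a sequence $(X_m)_{m\in\mathbb{N}}$ of closed subsets of $X$ with $X = \bigcup_{m} X_m$ such that, for every $m$, the restriction $\Phi|_{X_m} : X_m \to Y$ is proper (a continuous closed map with compact fibres; for Hausdorff $Y$ this means equivalently that preimages of compact sets are compact). Call $y \in Y$ a regular value of $\Phi$ if $D\Phi(x)$ is surjective for every $x \in \Phi^{-1}(y)$. Then the set of regular values of $\Phi$ is generic in $Y$, that is, it contains a countable intersection of dense open subsets of $Y$. -/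

import Mathlib

open scoped Manifold ContDiff

/-- A continuous map is paraproper if its domain is a countable union of closed sets
on each of which the map restricts to a proper map. -/
structure IsParaproper {X Y : Type*} [TopologicalSpace X] [TopologicalSpace Y]
    (Φ : X → Y) : Prop where
  continuous : Continuous Φ
  exists_exhaustion : ∃ K : ℕ → Set X, (⋃ m, K m) = Set.univ ∧
    ∀ m, IsClosed (K m) ∧ IsProperMap ((K m).domRestrict Φ)

section BanachManifold

variable (E F : Type*) [NormedAddCommGroup E] [NormedSpace ℝ E]
  [NormedAddCommGroup F] [NormedSpace ℝ F]
  {X Y : Type*} [TopologicalSpace X] [ChartedSpace E X]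
  [TopologicalSpace Y] [ChartedSpace F Y]

/-- A smooth Fredholm map between manifolds modelled on `E` and `F`: a smooth map whose
differential at every point is a Fredholm operator (of any index). -/
structure IsSmoothFredholmMap (Φ : X → Y) : Prop where
  contMDiff : ContMDiff 𝓘(ℝ, E) 𝓘(ℝ, F) ∞ Φ
  isFredholm_mfderiv : ∀ x : X, (mfderiv 𝓘(ℝ, E) 𝓘(ℝ, F) Φ x).IsFredholm

/-- The regular values of `Φ`: the points `y` such that the differential of `Φ` is surjective at
every point of the fibre over `y`. In particular, points outside the image are regular values. -/
def regularValues (Φ : X → Y) : Set Y :=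
  {y | ∀ x : X, Φ x = y → Function.Surjective (mfderiv 𝓘(ℝ, E) 𝓘(ℝ, F) Φ x)}

end BanachManifold

/-!
Near a point `x₀`, let `π` be a projection of the target onto the range of `DΦ(x₀)`. Since
`π ∘ DΦ(x₀)` is onto with finite-dimensional kernel `K`, the implicit function theorem gives
coordinates `(r, k)` with `k ∈ K` in which `π ∘ Φ` is `(r, k) ↦ r` (Lyapunov–Schmidt reduction).
Then `Φ` maps the slice over `r` into the affine space `π⁻¹(r)`, a translate of the
finite-dimensional space `ker π`, and the critical values of `Φ` in `π⁻¹(r)` are those of the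
restriction to this slice. They are meagre in it by Sard's theorem. As `K` is locally compact, the
critical values coming from a small closed ball form a closed set, which therefore has empty
interior. Properness on each `X_m` turns this local statement into a global one.

Sard's theorem is only needed in its topological form, which avoids Fubini: it follows by induction
on the dimension of the source. Where the derivative does not vanish, the reduction above with a
linear functional `π` lowers the dimension. Where some derivative of order `i` vanishes but one of
order `i + 1` does not, the point lies on a regular hypersurface of zeros of a partial derivative.
Where all derivatives up to an order `k ≥ dim E` vanish, `f` is Hölder of exponent `k + 1` by
Taylor's formula, so the Hausdorff dimension of the image is at most `dim E / (k + 1) < 1`.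
-/

open Set Filter Topology Module Function

section NowhereDense

variable {ι X Y F : Type*} [TopologicalSpace X] [TopologicalSpace Y] [TopologicalSpace F]

theorem isNowhereDense_union {s t : Set Y} (hs : IsNowhereDense s) (ht : IsNowhereDense t) :
    IsNowhereDense (s ∪ t) := by
  rw [IsNowhereDense, closure_union, interior_union_isClosed_of_interior_empty isClosed_closure ht]
  exact hs

theorem isNowhereDense_biUnion_finset {t : Finset ι} {s : ι → Set Y}
    (hs : ∀ i ∈ t, IsNowhereDense (s i)) : IsNowhereDense (⋃ i ∈ t, s i) := by
  classical
  induction t using Finset.induction_on with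
  | empty => simp
  | insert i t _ ih =>
    rw [Finset.set_biUnion_insert]
    exact isNowhereDense_union (hs i (Finset.mem_insert_self i t))
      (ih fun j hj ↦ hs j (Finset.mem_insert_of_mem hj))

theorem isNowhereDense_of_locally {s : Set Y}
    (h : ∀ y, ∃ V ∈ 𝓝 y, IsNowhereDense (V ∩ s)) : IsNowhereDense s := by
  refine eq_empty_iff_forall_notMem.2 fun y hy ↦ ?_
  obtain ⟨V, hV, hVs⟩ := h y
  have hsub : interior V ∩ interior (closure s) ⊆ closure (V ∩ s) :=
    (inter_subset_inter_right _ interior_subset).trans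
      (isOpen_interior.inter_closure.trans
        (closure_mono (inter_subset_inter_left _ interior_subset)))
  have hmem : y ∈ interior (closure (V ∩ s)) :=
    interior_maximal hsub (isOpen_interior.inter isOpen_interior)
      ⟨mem_interior_iff_mem_nhds.2 hV, hy⟩
  exact hVs.le hmem

theorem isNowhereDense_source_inter_preimage (e : OpenPartialHomeomorph Y F) {S : Set F}
    (hS : IsNowhereDense S) : IsNowhereDense (e.source ∩ e ⁻¹' S) := by
  rw [isNowhereDense_iff_disjoint, disjoint_left]
  rintro y ⟨hy, -⟩ hyS
  have hsub : e.source ∩ closure (e.source ∩ e ⁻¹' S) ⊆ e.source ∩ e ⁻¹' closure S := by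
    rw [e.preimage_closure]
    exact inter_subset_inter_right _ (closure_mono inter_subset_right)
  have hmem : y ∈ e.source ∩ e ⁻¹' interior (closure S) := by
    rw [e.preimage_interior]
    have hint := interior_mono hsub
    rw [interior_inter, interior_inter, e.open_source.interior_eq] at hint
    exact ⟨hy, (hint ⟨hy, hyS⟩).2⟩
  exact hS.le hmem.2

/-- The fibre over a point is compact, so finitely many of the given neighbourhoods cover it; since
the map is closed, they also cover the nearby fibres. -/
theorem isNowhereDense_image_of_isProperMap {f : X → Y} (hf : IsProperMap f) {C : Set X}
    (hC : ∀ x, ∃ U ∈ 𝓝 x, IsNowhereDense (f '' (U ∩ C))) : IsNowhereDense (f '' C) := by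
  refine isNowhereDense_of_locally fun y ↦ ?_
  choose U hU hUC using hC
  have hfibre : IsCompact (f ⁻¹' {y}) := hf.isCompact_preimage isCompact_singleton
  obtain ⟨t, -, ht⟩ := hfibre.elim_nhds_subcover_nhdsSet fun x _ ↦ hU x
  obtain ⟨V, hV, hVt⟩ := hf.isClosedMap.comap_nhds_le ht
  refine ⟨V, hV, (isNowhereDense_biUnion_finset (t := t) fun x _ ↦ hUC x).mono ?_⟩
  rintro _ ⟨hxV, x, hxC, rfl⟩
  obtain ⟨i, hi, hxi⟩ := mem_iUnion₂.1 (hVt hxV)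
  exact mem_iUnion₂.2 ⟨i, hi, x, ⟨hxi, hxC⟩, rfl⟩

theorem isMeagre_image_of_iUnion_eq_univ [Countable ι] {f : X → Y} {K : ι → Set X}
    (hK : ⋃ i, K i = univ) (hf : ∀ i, IsProperMap ((K i).domRestrict f)) {C : Set X}
    (hC : ∀ x, ∃ U ∈ 𝓝 x, IsNowhereDense (f '' (U ∩ C))) : IsMeagre (f '' C) := by
  have hnd (i : ι) : IsNowhereDense ((K i).domRestrict f '' (Subtype.val ⁻¹' C)) := by
    refine isNowhereDense_image_of_isProperMap (hf i) fun x ↦ ?_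
    obtain ⟨U, hU, hUC⟩ := hC x
    refine ⟨Subtype.val ⁻¹' U, continuous_subtype_val.continuousAt.preimage_mem_nhds hU,
      hUC.mono ?_⟩
    rintro _ ⟨z, hz, rfl⟩
    exact ⟨z, hz, rfl⟩
  refine (isMeagre_iUnion fun i ↦ (hnd i).isMeagre).mono ?_
  rintro _ ⟨x, hx, rfl⟩
  obtain ⟨i, hi⟩ := iUnion_eq_univ_iff.1 hK x
  exact mem_iUnion.2 ⟨i, ⟨x, hi⟩, hx, rfl⟩

theorem isMeagre_image_of_locally [SecondCountableTopology X] {f : X → Y} {A : Set X}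
    (h : ∀ x ∈ A, ∃ U ∈ 𝓝 x, IsMeagre (f '' (U ∩ A))) : IsMeagre (f '' A) := by
  choose! U hU hUA using h
  obtain ⟨t, htA, htc, ht⟩ := TopologicalSpace.countable_cover_nhdsWithin
    fun x hx ↦ mem_nhdsWithin_of_mem_nhds (a := x) (t := A) (hU x hx)
  have := htc.to_subtype
  refine (isMeagre_iUnion fun x : t ↦ hUA x (htA x.2)).mono ?_
  rintro _ ⟨x, hx, rfl⟩
  obtain ⟨i, hi, hxi⟩ := mem_iUnion₂.1 (ht hx)
  exact mem_iUnion.2 ⟨⟨i, hi⟩, x, ⟨hxi, hx⟩, rfl⟩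

/-- Properness in the second variable only: the first one is recovered from the value of `G`. -/
theorem isClosed_image_of_snd_mem_isCompact {R K : Type*} [TopologicalSpace R] [TopologicalSpace K]
    [T2Space F] {π : F → R} (hπ : Continuous π) {G : R × K → F} {Q : Set (R × K)}
    (hQ : IsClosed Q) (hG : ContinuousOn G Q) (hπG : ∀ z ∈ Q, π (G z) = z.1) {C : Set K}
    (hC : IsCompact C) (hQC : ∀ z ∈ Q, z.2 ∈ C) : IsClosed (G '' Q) := by
  have : CompactSpace C := isCompact_iff_compactSpace.1 hC
  let ι : F × C → R × K := fun p ↦ (π p.1, p.2)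
  have hι : Continuous ι := by fun_prop
  have hgraph : IsClosed (ι ⁻¹' Q ∩ {p | G (ι p) = p.1}) :=
    ((hG.comp hι.continuousOn fun _ h ↦ h).prodMk continuousOn_fst).preimage_isClosed_of_isClosed
      (hQ.preimage hι) isClosed_diagonal
  convert isClosedMap_fst_of_compactSpace _ hgraph
  ext y
  constructor
  · rintro ⟨z, hz, rfl⟩
    have hιz : ι (G z, ⟨z.2, hQC z hz⟩) = z := Prod.ext (hπG z hz) rfl
    exact ⟨(G z, ⟨z.2, hQC z hz⟩), ⟨by rwa [mem_preimage, hιz], congrArg G hιz⟩, rfl⟩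
  · rintro ⟨p, ⟨hp, hpG⟩, rfl⟩
    exact ⟨ι p, hp, hpG⟩

theorem isNowhereDense_of_isMeagre_preimage {S : Set Y} (hS : IsClosed S) {N : Type*}
    [TopologicalSpace N] [BaireSpace N]
    (h : ∀ y, ∃ γ : N → Y, Continuous γ ∧ y ∈ range γ ∧ IsMeagre (γ ⁻¹' S)) :
    IsNowhereDense S := by
  rw [hS.isNowhereDense_iff, eq_empty_iff_forall_notMem]
  intro y hy
  obtain ⟨γ, hγ, ⟨n, rfl⟩, hmeagre⟩ := h y
  exact not_isMeagre_of_isOpen (isOpen_interior.preimage hγ) ⟨n, hy⟩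
    (hmeagre.mono (preimage_mono interior_subset))

end NowhereDense

section Linear

variable {𝕜 E F R K : Type*} [NontriviallyNormedField 𝕜]
  [NormedAddCommGroup E] [NormedSpace 𝕜 E] [NormedAddCommGroup F] [NormedSpace 𝕜 F]

theorem isOpen_setOf_surjective [CompleteSpace 𝕜] [FiniteDimensional 𝕜 F] :
    IsOpen {T : E →L[𝕜] F | Surjective T} := by
  have := FiniteDimensional.complete 𝕜 F
  refine isOpen_iff_mem_nhds.2 fun T hT ↦ ?_
  obtain ⟨B, hB⟩ := T.exists_rightInverse_of_surjective (LinearMap.range_eq_top.2 hT)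
  have hcont : Continuous fun S : E →L[𝕜] F ↦ S ∘L B := by fun_prop
  have hmem : range ((↑) : (F ≃L[𝕜] F) → F →L[𝕜] F) ∈ 𝓝 (T ∘L B) :=
    ContinuousLinearEquiv.isOpen.mem_nhds ⟨.refl 𝕜 F, hB.symm⟩
  filter_upwards [hcont.continuousAt.eventually hmem] with S ⟨e, he⟩
  have hSB : Surjective (S ∘L B) := he ▸ e.surjective
  exact .of_comp hSB

variable [NormedAddCommGroup R] [NormedSpace 𝕜 R] [NormedAddCommGroup K] [NormedSpace 𝕜 K]

/-- Block elimination: modulo the first factor, `A` acts as its lower right block. -/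
theorem surjective_iff_surjective_proj_comp_inr {π : F →L[𝕜] R} {P : F →L[𝕜] π.ker}
    (hP : ∀ n : π.ker, P n = n) {A : R × K →L[𝕜] F} (hA : π ∘L A = .fst 𝕜 R K) :
    Surjective A ↔ Surjective (P ∘L A ∘L .inr 𝕜 R K) := by
  have hπA (z : R × K) : π (A z) = z.1 := DFunLike.congr_fun hA z
  have hinr (k : K) : A (0, k) = P (A (0, k)) :=
    congrArg Subtype.val (hP ⟨A (0, k), hπA (0, k)⟩).symm
  refine ⟨fun h n ↦ ?_, fun h y ↦ ?_⟩
  · obtain ⟨⟨r, k⟩, hz⟩ := h n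
    obtain rfl : r = 0 := (hπA (r, k)).symm.trans (hz ▸ n.2)
    exact ⟨k, by simpa [hz] using hP n⟩
  · have hy : y - A (π y, 0) ∈ π.ker := by simp [hπA]
    obtain ⟨k, hk⟩ := h ⟨_, hy⟩
    have hAk : A (0, k) = y - A (π y, 0) := (hinr k).trans (congrArg Subtype.val hk)
    refine ⟨(π y, k), ?_⟩
    rw [← Prod.fst_add_snd (π y, k), map_add, hAk, add_sub_cancel]

end Linear

section Straightening

variable {𝕜 E R : Type*} [RCLike 𝕜] [NormedAddCommGroup E] [NormedSpace 𝕜 E] [CompleteSpace E]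
  [NormedAddCommGroup R] [NormedSpace 𝕜 R] [CompleteSpace R]

theorem exists_openPartialHomeomorph_fst_eq {n : WithTop ℕ∞} (hn : n ≠ 0) {W : E → R} {s : Set E}
    (hs : IsOpen s) (hW : ContDiffOn 𝕜 n W s) {x₀ : E} (hx₀ : x₀ ∈ s) {W' : E →L[𝕜] R}
    (hW' : HasFDerivAt W W' x₀) (hsurj : Surjective W') (hker : W'.ker.ClosedComplemented) :
    ∃ ψ : OpenPartialHomeomorph E (R × W'.ker), x₀ ∈ ψ.source ∧ ψ.source ⊆ s ∧
      (∀ x, (ψ x).1 = W x) ∧ ContDiffOn 𝕜 n ψ.symm ψ.target := by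
  have hrange : W'.range = ⊤ := LinearMap.range_eq_top.2 hsurj
  have hstrict : HasStrictFDerivAt W W' x₀ :=
    (hW.contDiffAt (hs.mem_nhds hx₀)).hasStrictFDerivAt' hW' hn
  let ψ := hstrict.implicitToOpenPartialHomeomorphOfComplemented W W' hrange hker
  have hψ : ContDiffOn 𝕜 n ψ s :=
    hW.prodMk ((Classical.choose hker).contDiff.comp (contDiff_id.sub contDiff_const)).contDiffOn
  have hinv₀ : (fderiv 𝕜 ψ x₀).IsInvertible :=
    (hstrict.implicitFunctionDataOfComplemented W W' hrange hker).isInvertible_fderiv_prodFun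
  have hinv : {x ∈ s | (fderiv 𝕜 ψ x).IsInvertible} ∈ 𝓝 x₀ := by
    have hcont : ContinuousAt (fderiv 𝕜 ψ) x₀ :=
      (hψ.contDiffAt (hs.mem_nhds hx₀)).continuousAt_fderiv hn
    exact inter_mem (hs.mem_nhds hx₀) (hcont (ContinuousLinearEquiv.isOpen.mem_nhds hinv₀))
  obtain ⟨t, ht, hto, hxt⟩ := mem_nhds_iff.1 hinv
  refine ⟨ψ.restrOpen t hto, ⟨hstrict.mem_implicitToOpenPartialHomeomorphOfComplemented_source
    hrange hker, hxt⟩, fun x hx ↦ (ht hx.2).1, fun x ↦ rfl, fun z hz ↦ ?_⟩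
  have hmem := (ψ.restrOpen t hto).map_target hz
  obtain ⟨hzs, e, he⟩ := ht hmem.2
  have hψz : ContDiffAt 𝕜 n ψ _ := hψ.contDiffAt (hs.mem_nhds hzs)
  refine ((ψ.restrOpen t hto).contDiffAt_symm (f₀' := e) hz ?_ hψz).contDiffWithinAt
  rw [he]
  exact (hψz.differentiableAt hn).hasFDerivAt

end Straightening

section CriticalPoints

variable {E F : Type*} [NormedAddCommGroup E] [NormedSpace ℝ E] [NormedAddCommGroup F]
  [NormedSpace ℝ F]

/-- The critical points of a map between normed spaces: the points where its derivative is not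
surjective. Since `fderiv` is zero where the map is not differentiable, such points count as
critical unless `F` is trivial. -/
def criticalPoints (f : E → F) : Set E :=
  {x | ¬ Surjective (fderiv ℝ f x)}

variable (E F) in
/-- The topological Sard property of the pair `(E, F)`: the critical values of every smooth map
from an open subset of `E` to `F` form a meagre set. -/
def HasMeagreCriticalValues : Prop :=
  ∀ (g : E → F) (s : Set E), IsOpen s → ContDiffOn ℝ ∞ g s →
    IsMeagre (g '' (s ∩ criticalPoints g))

end CriticalPoints

section LyapunovSchmidt

variable {E F R K : Type*} [NormedAddCommGroup E] [NormedSpace ℝ E] [NormedAddCommGroup F]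
  [NormedSpace ℝ F] [NormedAddCommGroup R] [NormedSpace ℝ R] [NormedAddCommGroup K]
  [NormedSpace ℝ K]

/-- The Lyapunov–Schmidt normal form relative to a continuous linear map `π`: `G` is smooth on the
open set `t`, and in the coordinates of `t` the component `π ∘ G` is the first projection. -/
structure IsLyapunovSchmidtForm (π : F →L[ℝ] R) (G : R × K → F) (t : Set (R × K)) : Prop where
  isOpen : IsOpen t
  contDiffOn : ContDiffOn ℝ ∞ G t
  proj_eq : ∀ z ∈ t, π (G z) = z.1

/-- The Lyapunov–Schmidt reduced map at `y`: it compares `G` with `y` along the slice over `π y`,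
with values in `ker π` through a projection `P` onto it. -/
def reducedMap (π : F →L[ℝ] R) (P : F →L[ℝ] π.ker) (G : R × K → F) (y : F) (k : K) : π.ker :=
  P (G (π y, k) - y)

namespace IsLyapunovSchmidtForm

variable {π : F →L[ℝ] R} {P : F →L[ℝ] π.ker} {G : R × K → F} {t : Set (R × K)} {z : R × K} {y : F}

theorem hasFDerivAt (h : IsLyapunovSchmidtForm π G t) (hz : z ∈ t) :
    HasFDerivAt G (fderiv ℝ G z) z :=
  ((h.contDiffOn.contDiffAt (h.isOpen.mem_nhds hz)).differentiableAt (by simp)).hasFDerivAt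

theorem proj_comp_fderiv (h : IsLyapunovSchmidtForm π G t) (hz : z ∈ t) :
    π ∘L fderiv ℝ G z = .fst ℝ R K :=
  (π.hasFDerivAt.comp z (h.hasFDerivAt hz)).unique
    (hasFDerivAt_fst.congr_of_eventuallyEq (eventually_of_mem (h.isOpen.mem_nhds hz) h.proj_eq))

theorem mem_criticalPoints_iff (h : IsLyapunovSchmidtForm π G t) (hP : ∀ n : π.ker, P n = n)
    (hz : z ∈ t) : z ∈ criticalPoints G ↔ ¬ Surjective (P ∘L fderiv ℝ G z ∘L .inr ℝ R K) :=
  (surjective_iff_surjective_proj_comp_inr hP (h.proj_comp_fderiv hz)).not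

theorem mem_criticalPoints_iff_reducedMap (h : IsLyapunovSchmidtForm π G t)
    (hP : ∀ n : π.ker, P n = n) {k : K} (hk : (π y, k) ∈ t) :
    (π y, k) ∈ criticalPoints G ↔ k ∈ criticalPoints (reducedMap π P G y) := by
  have hd : HasFDerivAt (reducedMap π P G y) (P ∘L fderiv ℝ G (π y, k) ∘L .inr ℝ R K) k :=
    P.hasFDerivAt.comp k
      (((h.hasFDerivAt hk).comp k (hasFDerivAt_prodMk_right (π y) k)).sub_const y)
  rw [h.mem_criticalPoints_iff hP hk, criticalPoints, mem_ofPred_eq, hd.fderiv]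

theorem contDiffOn_reducedMap (h : IsLyapunovSchmidtForm π G t) :
    ContDiffOn ℝ ∞ (reducedMap π P G y) (Prod.mk (π y) ⁻¹' t) :=
  P.contDiff.comp_contDiffOn
    ((h.contDiffOn.comp (contDiff_prodMk_right (π y)).contDiffOn fun _ hk ↦ hk).sub
      contDiffOn_const)

theorem isMeagre_preimage_image_criticalPoints (h : IsLyapunovSchmidtForm π G t)
    (hπ : π.ker.ClosedComplemented) (hSard : HasMeagreCriticalValues K π.ker) (y : F) :
    IsMeagre ((fun n : π.ker ↦ y + n) ⁻¹' (G '' (t ∩ criticalPoints G))) := by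
  obtain ⟨P, hP⟩ := hπ
  refine (hSard (reducedMap π P G y) _ (h.isOpen.preimage (by fun_prop))
    h.contDiffOn_reducedMap).mono ?_
  rintro n ⟨⟨r, k⟩, ⟨hz, hcrit⟩, hGz⟩
  have hn : π n = 0 := n.2
  have hr : π (G (r, k)) = π y := by rw [hGz, map_add, hn, add_zero]
  obtain rfl : r = π y := (h.proj_eq _ hz).symm.trans hr
  refine ⟨k, ⟨hz, (h.mem_criticalPoints_iff_reducedMap hP hz).1 hcrit⟩, ?_⟩
  rw [reducedMap, hGz, add_sub_cancel_left, hP]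

theorem isClosed_inter_criticalPoints [FiniteDimensional ℝ π.ker] (h : IsLyapunovSchmidtForm π G t)
    (hπ : π.ker.ClosedComplemented) {D : Set (R × K)} (hD : IsClosed D) (hDt : D ⊆ t) :
    IsClosed (D ∩ criticalPoints G) := by
  obtain ⟨P, hP⟩ := hπ
  have hcont : ContinuousOn (fun z ↦ P ∘L fderiv ℝ G z ∘L .inr ℝ R K) D := by
    have := (h.contDiffOn.continuousOn_fderiv_of_isOpen h.isOpen (by simp)).mono hDt
    fun_prop
  convert hcont.preimage_isClosed_of_isClosed hD isOpen_setOf_surjective.isClosed_compl using 1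
  ext z
  exact and_congr_right fun hz ↦ h.mem_criticalPoints_iff hP (hDt hz)

theorem exists_nhds_isNowhereDense_image_criticalPoints [ProperSpace K]
    [FiniteDimensional ℝ π.ker] (h : IsLyapunovSchmidtForm π G t)
    (hSard : HasMeagreCriticalValues K π.ker) (hz : z ∈ t) :
    ∃ V ∈ 𝓝 z, IsNowhereDense (G '' (V ∩ criticalPoints G)) := by
  have hπ : π.ker.ClosedComplemented := .of_finiteDimensional _
  obtain ⟨r, hr, hball⟩ := Metric.nhds_basis_closedBall.mem_iff.1 (h.isOpen.mem_nhds hz)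
  refine ⟨Metric.closedBall z r, Metric.closedBall_mem_nhds z hr,
    isNowhereDense_of_isMeagre_preimage ?_ fun y ↦ ⟨fun n : π.ker ↦ y + n, by fun_prop,
      ⟨0, by simp⟩, ?_⟩⟩
  · refine isClosed_image_of_snd_mem_isCompact π.continuous
      (h.isClosed_inter_criticalPoints hπ Metric.isClosed_closedBall hball)
      (h.contDiffOn.continuousOn.mono fun w hw ↦ hball hw.1) (fun w hw ↦ h.proj_eq w (hball hw.1))
      (isCompact_closedBall z.2 r) fun w hw ↦ ?_
    exact (le_max_right (dist w.1 z.1) _).trans hw.1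
  · exact (h.isMeagre_preimage_image_criticalPoints hπ hSard y).mono
      (preimage_mono (image_mono (inter_subset_inter_left _ hball)))

end IsLyapunovSchmidtForm

theorem exists_isLyapunovSchmidtForm [CompleteSpace E] [CompleteSpace R] {Φ : E → F} {s : Set E}
    (hs : IsOpen s) (hΦ : ContDiffOn ℝ ∞ Φ s) {x₀ : E} (hx₀ : x₀ ∈ s) {Φ' : E →L[ℝ] F}
    (hΦ' : HasFDerivAt Φ Φ' x₀) {π : F →L[ℝ] R} (hsurj : Surjective (π ∘L Φ'))
    (hker : (π ∘L Φ').ker.ClosedComplemented) :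
    ∃ ψ : OpenPartialHomeomorph E (R × (π ∘L Φ').ker), x₀ ∈ ψ.source ∧ ψ.source ⊆ s ∧
      ContDiffOn ℝ ∞ ψ.symm ψ.target ∧ IsLyapunovSchmidtForm π (Φ ∘ ψ.symm) ψ.target := by
  obtain ⟨ψ, hx, hψs, hfst, hsymm⟩ := exists_openPartialHomeomorph_fst_eq (by simp) hs
    (π.contDiff.comp_contDiffOn hΦ) hx₀ (π.hasFDerivAt.comp x₀ hΦ') hsurj hker
  refine ⟨ψ, hx, hψs, hsymm, ψ.open_target,
    hΦ.comp hsymm fun z hz ↦ hψs (ψ.map_target hz), fun z hz ↦ ?_⟩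
  exact (hfst _).symm.trans (congrArg Prod.fst (ψ.right_inv hz))

theorem exists_nhds_isNowhereDense_image_criticalPoints_of_surjective [CompleteSpace E]
    [CompleteSpace R] {Φ : E → F} {s : Set E} (hs : IsOpen s) (hΦ : ContDiffOn ℝ ∞ Φ s) {x₀ : E}
    (hx₀ : x₀ ∈ s) {Φ' : E →L[ℝ] F} (hΦ' : HasFDerivAt Φ Φ' x₀) {π : F →L[ℝ] R}
    (hsurj : Surjective (π ∘L Φ')) [FiniteDimensional ℝ (π ∘L Φ').ker] [FiniteDimensional ℝ π.ker]
    (hSard : HasMeagreCriticalValues (π ∘L Φ').ker π.ker) :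
    ∃ U ∈ 𝓝 x₀, IsNowhereDense (Φ '' (U ∩ criticalPoints Φ)) := by
  have := FiniteDimensional.proper_real (π ∘L Φ').ker
  obtain ⟨ψ, hx, hψs, hsymm, hform⟩ := exists_isLyapunovSchmidtForm hs hΦ hx₀ hΦ' hsurj
    (.of_finiteDimensional _)
  obtain ⟨V, hV, hd⟩ :=
    hform.exists_nhds_isNowhereDense_image_criticalPoints hSard (ψ.map_source hx)
  refine ⟨ψ.source ∩ ψ ⁻¹' V,
    inter_mem (ψ.open_source.mem_nhds hx) ((ψ.continuousAt hx).preimage_mem_nhds hV), hd.mono ?_⟩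
  rintro _ ⟨x, ⟨⟨hxs, hxV⟩, hcrit⟩, rfl⟩
  have hinv : ψ.symm (ψ x) = x := ψ.left_inv hxs
  refine ⟨ψ x, ⟨hxV, fun hG ↦ hcrit ?_⟩, congrArg Φ hinv⟩
  have hΦx : DifferentiableAt ℝ Φ (ψ.symm (ψ x)) :=
    hinv.symm ▸ (hΦ.contDiffAt (hs.mem_nhds (hψs hxs))).differentiableAt (by simp)
  have hψx : DifferentiableAt ℝ ψ.symm (ψ x) :=
    (hsymm.contDiffAt (ψ.open_target.mem_nhds (ψ.map_source hxs))).differentiableAt (by simp)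
  rw [fderiv_comp _ hΦx hψx, hinv] at hG
  exact .of_comp hG

end LyapunovSchmidt

section Taylor

variable {E F : Type*} [NormedAddCommGroup E] [NormedSpace ℝ E] [NormedAddCommGroup F]
  [NormedSpace ℝ F] {f : E → F} {s : Set E} {M : ℝ} {x y : E}

theorem norm_sub_le_mul_pow_of_norm_fderiv_le {k : ℕ} (hs : Convex ℝ s) (hM : 0 ≤ M)
    (hf : ∀ z ∈ s, DifferentiableAt ℝ f z) (hx : x ∈ s)
    (hbound : ∀ z ∈ s, ‖fderiv ℝ f z‖ ≤ M * ‖z - x‖ ^ k) (hy : y ∈ s) :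
    ‖f y - f x‖ ≤ M * ‖y - x‖ ^ (k + 1) := by
  have hseg : segment ℝ x y ⊆ s := hs.segment_subset hx hy
  have hle : ∀ z ∈ segment ℝ x y, ‖fderiv ℝ f z‖ ≤ M * ‖y - x‖ ^ k := fun z hz ↦
    (hbound z (hseg hz)).trans (by gcongr; exact norm_sub_le_of_mem_segment hz)
  calc ‖f y - f x‖ ≤ M * ‖y - x‖ ^ k * ‖y - x‖ :=
        (convex_segment x y).norm_image_sub_le_of_norm_fderiv_le
          (fun z hz ↦ hf z (hseg hz)) hle (left_mem_segment ℝ x y) (right_mem_segment ℝ x y)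
    _ = M * ‖y - x‖ ^ (k + 1) := by ring

theorem norm_iteratedFDeriv_le_mul_pow {i j : ℕ} (hs : Convex ℝ s)
    (hf : ∀ z ∈ s, ContDiffAt ℝ (i + j : ℕ) f z)
    (hbound : ∀ z ∈ s, ‖iteratedFDeriv ℝ (i + j) f z‖ ≤ M) (hx : x ∈ s)
    (h0 : ∀ m ∈ Ico i (i + j), iteratedFDeriv ℝ m f x = 0) (hy : y ∈ s) :
    ‖iteratedFDeriv ℝ i f y‖ ≤ M * ‖y - x‖ ^ j := by
  induction j generalizing i y with
  | zero => simpa using hbound y hy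
  | succ j ih =>
    have hM : 0 ≤ M := (norm_nonneg _).trans (hbound x hx)
    rw [← Nat.succ_add_eq_add_succ] at hf hbound h0
    have hderiv : ∀ z ∈ s, ‖fderiv ℝ (iteratedFDeriv ℝ i f) z‖ ≤ M * ‖z - x‖ ^ j := fun z hz ↦ by
      rw [norm_fderiv_iteratedFDeriv]
      exact ih hf hbound (fun m hm ↦ h0 m ⟨Nat.le_of_succ_le hm.1, hm.2⟩) hz
    have hdiff : ∀ z ∈ s, DifferentiableAt ℝ (iteratedFDeriv ℝ i f) z := fun z hz ↦
      (hf z hz).differentiableAt_iteratedFDeriv (by norm_cast; omega)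
    have := norm_sub_le_mul_pow_of_norm_fderiv_le hs hM hdiff hx hderiv hy
    rwa [h0 i ⟨le_rfl, by omega⟩, sub_zero] at this

theorem norm_sub_le_mul_pow_of_norm_iteratedFDeriv_le {k : ℕ} (hs : Convex ℝ s)
    (hf : ∀ z ∈ s, ContDiffAt ℝ (k + 1 : ℕ) f z)
    (hbound : ∀ z ∈ s, ‖iteratedFDeriv ℝ (k + 1) f z‖ ≤ M) (hx : x ∈ s)
    (h0 : ∀ i ∈ Icc 1 k, iteratedFDeriv ℝ i f x = 0) (hy : y ∈ s) :
    ‖f y - f x‖ ≤ M * ‖y - x‖ ^ (k + 1) := by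
  refine norm_sub_le_mul_pow_of_norm_fderiv_le hs ((norm_nonneg _).trans (hbound x hx))
    (fun z hz ↦ (hf z hz).differentiableAt (by simp)) hx (fun z hz ↦ ?_) hy
  rw [add_comm k 1] at hf hbound
  rw [← norm_iteratedFDeriv_one]
  exact norm_iteratedFDeriv_le_mul_pow hs hf hbound hx
    (fun m hm ↦ h0 m ⟨hm.1, by have := hm.2; omega⟩) hz

theorem exists_holderOnWith_of_iteratedFDeriv_eq_zero {k : ℕ} {A : Set E}
    (hf : ContDiffAt ℝ (k + 1 : ℕ) f x) (h0 : ∀ a ∈ A, ∀ i ∈ Icc 1 k, iteratedFDeriv ℝ i f a = 0) :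
    ∃ C, ∃ t ∈ 𝓝[A] x, HolderOnWith C (k + 1 : ℕ) f t := by
  set M : ℝ := ‖iteratedFDeriv ℝ (k + 1) f x‖ + 1
  have hbound : ∀ᶠ z in 𝓝 x, ‖iteratedFDeriv ℝ (k + 1) f z‖ < M :=
    (hf.continuousAt_iteratedFDeriv le_rfl).norm.eventually_lt_const (lt_add_one _)
  obtain ⟨r, hr, hball⟩ :=
    Metric.eventually_nhds_iff_ball.1 ((hf.eventually (by simp)).and hbound)
  refine ⟨M.toNNReal, A ∩ Metric.ball x r, inter_mem_nhdsWithin A (Metric.ball_mem_nhds x hr),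
    fun b hb a ha ↦ ?_⟩
  have hle : ‖f b - f a‖ ≤ M * ‖b - a‖ ^ (k + 1) :=
    norm_sub_le_mul_pow_of_norm_iteratedFDeriv_le (convex_ball x r) (fun z hz ↦ (hball z hz).1)
      (fun z hz ↦ (hball z hz).2.le) ha.2 (h0 a ha.1) hb.2
  have hM : 0 ≤ M := by positivity
  rw [NNReal.coe_natCast, ENNReal.rpow_natCast, edist_nndist, edist_nndist,
    ← ENNReal.coe_pow, ← ENNReal.coe_mul, ENNReal.coe_le_coe, ← NNReal.coe_le_coe]
  simpa [dist_eq_norm, Real.coe_toNNReal M hM] using hle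

theorem dimH_image_le_of_iteratedFDeriv_eq_zero [FiniteDimensional ℝ E] {k : ℕ} {A : Set E}
    (hf : ∀ x ∈ A, ContDiffAt ℝ (k + 1 : ℕ) f x)
    (h0 : ∀ a ∈ A, ∀ i ∈ Icc 1 k, iteratedFDeriv ℝ i f a = 0) :
    dimH (f '' A) ≤ finrank ℝ E / (k + 1 : ℕ) := by
  calc dimH (f '' A) ≤ dimH A / ((k + 1 : ℕ) : NNReal) :=
        dimH_image_le_of_locally_holder_on (by positivity)
          fun x hx ↦ exists_holderOnWith_of_iteratedFDeriv_eq_zero (hf x hx) h0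
    _ ≤ finrank ℝ E / (k + 1 : ℕ) := by
        rw [ENNReal.coe_natCast, ← Real.dimH_univ_eq_finrank E]
        gcongr
        exact subset_univ A

end Taylor

section Sard

variable {E F R : Type*} [NormedAddCommGroup E] [NormedSpace ℝ E] [NormedAddCommGroup F]
  [NormedSpace ℝ F] [NormedAddCommGroup R] [NormedSpace ℝ R] {f : E → F} {s : Set E}

theorem isClosed_inter_setOf_iteratedFDeriv_eq_zero (hs : IsOpen s) {k : ℕ}
    (hf : ContDiffOn ℝ k f s) {D : Set E} (hD : IsClosed D) (hDs : D ⊆ s) :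
    IsClosed (D ∩ {x ∈ s | ∀ i ∈ Icc 1 k, iteratedFDeriv ℝ i f x = 0}) := by
  have hcont : ∀ i ∈ Icc 1 k, ContinuousOn (iteratedFDeriv ℝ i f) D := fun i hi x hx ↦
    (((hf.contDiffAt (hs.mem_nhds (hDs hx))).continuousAt_iteratedFDeriv
      (by exact_mod_cast hi.2))).continuousWithinAt
  convert hD.inter (isClosed_biInter fun i hi ↦
    (hcont i hi).preimage_isClosed_of_isClosed hD (isClosed_singleton (x := 0))) using 1
  ext x
  simp only [mem_inter_iff, mem_ofPred_eq, mem_iInter, mem_preimage, mem_singleton_iff]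
  exact ⟨fun ⟨hx, h⟩ ↦ ⟨hx, fun i hi ↦ ⟨hx, h.2 i hi⟩⟩,
    fun ⟨hx, h⟩ ↦ ⟨hx, hDs hx, fun i hi ↦ (h i hi).2⟩⟩

theorem isMeagre_image_setOf_iteratedFDeriv_eq_zero [FiniteDimensional ℝ E]
    [FiniteDimensional ℝ F] [Nontrivial F] (hs : IsOpen s) {k : ℕ} (hk : finrank ℝ E ≤ k)
    (hf : ContDiffOn ℝ (k + 1 : ℕ) f s) :
    IsMeagre (f '' {x ∈ s | ∀ i ∈ Icc 1 k, iteratedFDeriv ℝ i f x = 0}) := by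
  have := FiniteDimensional.proper_real E
  refine isMeagre_image_of_locally fun x hx ↦ ?_
  obtain ⟨r, hr, hball⟩ := Metric.nhds_basis_closedBall.mem_iff.1 (hs.mem_nhds hx.1)
  refine ⟨Metric.closedBall x r, Metric.closedBall_mem_nhds x hr, IsNowhereDense.isMeagre ?_⟩
  set A := Metric.closedBall x r ∩ {x ∈ s | ∀ i ∈ Icc 1 k, iteratedFDeriv ℝ i f x = 0}
  have hA : IsCompact A := (isCompact_closedBall x r).of_isClosed_subset
    (isClosed_inter_setOf_iteratedFDeriv_eq_zero hs (hf.of_le (by norm_cast; omega))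
      Metric.isClosed_closedBall hball) inter_subset_left
  have hfA : IsCompact (f '' A) := hA.image_of_continuousOn (hf.continuousOn.mono fun z hz ↦ hz.2.1)
  have hdim : dimH (f '' A) < finrank ℝ F :=
    calc dimH (f '' A) ≤ finrank ℝ E / (k + 1 : ℕ) := dimH_image_le_of_iteratedFDeriv_eq_zero
          (fun z hz ↦ hf.contDiffAt (hs.mem_nhds hz.2.1)) fun z hz ↦ hz.2.2
      _ < 1 := ENNReal.div_lt_of_lt_mul (by rw [one_mul]; exact_mod_cast Nat.lt_succ_of_le hk)
      _ ≤ finrank ℝ F := by exact_mod_cast finrank_pos (R := ℝ) (M := F)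
  rw [hfA.isClosed.isNowhereDense_iff, ← not_nonempty_iff_eq_empty]
  exact fun hint ↦ hdim.ne (Real.dimH_of_nonempty_interior hint)

theorem exists_nhds_isMeagre_image_criticalPoints_inter_fibre [CompleteSpace E] [CompleteSpace R]
    (hs : IsOpen s) (hf : ContDiffOn ℝ ∞ f s) {W : E → R} (hW : ContDiffOn ℝ ∞ W s) {x : E}
    (hx : x ∈ s) {W' : E →L[ℝ] R} (hW' : HasFDerivAt W W' x) (hsurj : Surjective W')
    (hker : W'.ker.ClosedComplemented) (hSard : HasMeagreCriticalValues W'.ker F) (r : R) :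
    ∃ U ∈ 𝓝 x, IsMeagre (f '' (U ∩ (criticalPoints f ∩ W ⁻¹' {r}))) := by
  obtain ⟨ψ, hxψ, hψs, hfst, hsymm⟩ :=
    exists_openPartialHomeomorph_fst_eq (by simp) hs hW hx hW' hsurj hker
  let θ : W'.ker → E := fun k ↦ ψ.symm (r, k)
  let t : Set W'.ker := Prod.mk r ⁻¹' ψ.target
  have ht : IsOpen t := ψ.open_target.preimage (by fun_prop)
  have hθ : ContDiffOn ℝ ∞ θ t := hsymm.comp (contDiff_prodMk_right r).contDiffOn fun k hk ↦ hk
  have hθs : MapsTo θ t s := fun k hk ↦ hψs (ψ.map_target hk)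
  refine ⟨ψ.source, ψ.open_source.mem_nhds hxψ, (hSard (f ∘ θ) t ht (hf.comp hθ hθs)).mono ?_⟩
  rintro _ ⟨z, ⟨hz, hcrit, rfl⟩, rfl⟩
  have hψz : ψ z = (W z, (ψ z).2) := Prod.ext (hfst z) rfl
  have hmem : (ψ z).2 ∈ t := by rw [mem_preimage, ← hψz]; exact ψ.map_source hz
  have hθz : θ (ψ z).2 = z := by simp only [θ, ← hψz, ψ.left_inv hz]
  refine ⟨(ψ z).2, ⟨hmem, fun hsurj ↦ hcrit ?_⟩, congrArg f hθz⟩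
  rw [fderiv_comp _ ((hf.contDiffAt (hs.mem_nhds (hθs hmem))).differentiableAt (by simp))
    ((hθ.contDiffAt (ht.mem_nhds hmem)).differentiableAt (by simp)), hθz] at hsurj
  exact .of_comp hsurj

theorem surjective_of_ne_zero {φ : E →L[ℝ] ℝ} (hφ : φ ≠ 0) : Surjective φ :=
  LinearMap.surjective fun h ↦ hφ (ContinuousLinearMap.coe_injective h)

theorem finrank_ker_lt [FiniteDimensional ℝ E] {φ : E →L[ℝ] ℝ} (hφ : φ ≠ 0) :
    finrank ℝ φ.ker < finrank ℝ E :=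
  Submodule.finrank_lt fun h ↦ hφ (ContinuousLinearMap.coe_injective (LinearMap.ker_eq_top.1 h))

theorem isMeagre_image_criticalPoints_fderiv_ne_zero [FiniteDimensional ℝ E]
    [FiniteDimensional ℝ F] (hs : IsOpen s) (hf : ContDiffOn ℝ ∞ f s)
    (hSard : ∀ (φ : E →L[ℝ] ℝ) (l : F →L[ℝ] ℝ), φ ≠ 0 → HasMeagreCriticalValues φ.ker l.ker) :
    IsMeagre (f '' {x ∈ s | x ∈ criticalPoints f ∧ fderiv ℝ f x ≠ 0}) := by
  have := FiniteDimensional.proper_real E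
  refine isMeagre_image_of_locally fun x ⟨hx, _, hne⟩ ↦ ?_
  obtain ⟨v, hv⟩ := DFunLike.exists_ne hne
  obtain ⟨l, hl⟩ := SeparatingDual.exists_ne_zero (R := ℝ) hv
  have hφ : l ∘L fderiv ℝ f x ≠ 0 := fun h ↦ hl (DFunLike.congr_fun h v)
  obtain ⟨U, hU, hd⟩ := exists_nhds_isNowhereDense_image_criticalPoints_of_surjective hs hf hx
    ((hf.contDiffAt (hs.mem_nhds hx)).differentiableAt (by simp)).hasFDerivAt
    (surjective_of_ne_zero hφ) (hSard _ l hφ)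
  exact ⟨U, hU, hd.isMeagre.mono (image_mono (inter_subset_inter_right U fun z hz ↦ hz.2.1))⟩

theorem isMeagre_image_criticalPoints_iteratedFDeriv_ne_zero [FiniteDimensional ℝ E] (hs : IsOpen s)
    (hf : ContDiffOn ℝ ∞ f s)
    (hSard : ∀ φ : E →L[ℝ] ℝ, φ ≠ 0 → HasMeagreCriticalValues φ.ker F) (i : ℕ) :
    IsMeagre (f '' {x ∈ s | x ∈ criticalPoints f ∧
      iteratedFDeriv ℝ i f x = 0 ∧ iteratedFDeriv ℝ (i + 1) f x ≠ 0}) := by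
  have := FiniteDimensional.proper_real E
  refine isMeagre_image_of_locally fun x ⟨hx, _, _, hne⟩ ↦ ?_
  obtain ⟨m, hm⟩ := DFunLike.exists_ne hne
  obtain ⟨l, hl⟩ := SeparatingDual.exists_ne_zero (R := ℝ) hm
  let L : (E [×i]→L[ℝ] F) →L[ℝ] ℝ :=
    l ∘L ContinuousMultilinearMap.apply ℝ (fun _ : Fin i ↦ E) F (Fin.tail m)
  let w : E → ℝ := fun z ↦ L (iteratedFDeriv ℝ i f z)
  have hDi : ContDiffOn ℝ ∞ (iteratedFDeriv ℝ i f) s := fun z hz ↦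
    ((hf.contDiffAt (hs.mem_nhds hz)).iteratedFDeriv_right
      (by exact_mod_cast le_top)).contDiffWithinAt
  have hw : HasFDerivAt w (L ∘L fderiv ℝ (iteratedFDeriv ℝ i f) x) x :=
    L.hasFDerivAt.comp x
      ((hDi.contDiffAt (hs.mem_nhds hx)).differentiableAt (by simp)).hasFDerivAt
  have hw0 : L ∘L fderiv ℝ (iteratedFDeriv ℝ i f) x ≠ 0 := fun h ↦ hl <| by
    rw [iteratedFDeriv_succ_apply_left]
    exact DFunLike.congr_fun h (m 0)
  obtain ⟨U, hU, hd⟩ := exists_nhds_isMeagre_image_criticalPoints_inter_fibre hs hf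
    (L.contDiff.comp_contDiffOn hDi) hx hw (surjective_of_ne_zero hw0)
    (.of_finiteDimensional _) (hSard _ hw0) 0
  refine ⟨U, hU, hd.mono (image_mono (inter_subset_inter_right U ?_))⟩
  exact fun z hz ↦ ⟨hz.2.1, (congrArg L hz.2.2.1).trans (map_zero L)⟩

theorem inter_criticalPoints_subset (s : Set E) (f : E → F) (k : ℕ) :
    s ∩ criticalPoints f ⊆ {x ∈ s | x ∈ criticalPoints f ∧ fderiv ℝ f x ≠ 0} ∪
      (⋃ i, {x ∈ s | x ∈ criticalPoints f ∧
        iteratedFDeriv ℝ i f x = 0 ∧ iteratedFDeriv ℝ (i + 1) f x ≠ 0}) ∪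
      {x ∈ s | ∀ i ∈ Icc 1 k, iteratedFDeriv ℝ i f x = 0} := by
  rintro x ⟨hx, hcrit⟩
  by_cases h1 : fderiv ℝ f x = 0
  swap
  · exact .inl (.inl ⟨hx, hcrit, h1⟩)
  by_cases hstep : ∃ i, iteratedFDeriv ℝ i f x = 0 ∧ iteratedFDeriv ℝ (i + 1) f x ≠ 0
  · obtain ⟨i, hi⟩ := hstep
    exact .inl (.inr (mem_iUnion.2 ⟨i, hx, hcrit, hi⟩))
  refine .inr ⟨hx, fun i hi ↦ ?_⟩
  push Not at hstep
  induction i, hi.1 using Nat.le_induction with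
  | base => rw [← norm_eq_zero, norm_iteratedFDeriv_one, h1, norm_zero]
  | succ i hi' ih => exact hstep i (ih ⟨hi', by have := hi.2; omega⟩)

theorem hasMeagreCriticalValues [FiniteDimensional ℝ E] [FiniteDimensional ℝ F] :
    HasMeagreCriticalValues E F := by
  induction hn : finrank ℝ E using Nat.strong_induction_on generalizing E F with
  | _ n ih =>
  intro f s hs hf
  rcases subsingleton_or_nontrivial F with hF | hF
  · have : criticalPoints f = ∅ :=
      eq_empty_of_forall_notMem fun x hx ↦ hx (surjective_to_subsingleton _)
    simp only [this, inter_empty, image_empty, IsMeagre.empty]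
  have hker : ∀ φ : E →L[ℝ] ℝ, φ ≠ 0 → finrank ℝ φ.ker < n := fun φ hφ ↦ hn ▸ finrank_ker_lt hφ
  refine IsMeagre.mono (image_mono (inter_criticalPoints_subset s f n)) ?_
  rw [image_union, image_union, image_iUnion]
  exact ((isMeagre_image_criticalPoints_fderiv_ne_zero hs hf
      fun φ l hφ ↦ ih _ (hker φ hφ) rfl).union
    (isMeagre_iUnion fun i ↦ isMeagre_image_criticalPoints_iteratedFDeriv_ne_zero hs hf
      (fun φ hφ ↦ ih _ (hker φ hφ) rfl) i)).union
    (isMeagre_image_setOf_iteratedFDeriv_eq_zero hs hn.le (hf.of_le (by exact_mod_cast le_top)))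

end Sard

section Fredholm

variable {E F : Type*} [NormedAddCommGroup E] [NormedSpace ℝ E] [CompleteSpace E]
  [NormedAddCommGroup F] [NormedSpace ℝ F] [CompleteSpace F]

theorem exists_nhds_isNowhereDense_image_criticalPoints_of_isFredholm {Φ : E → F} {s : Set E}
    (hs : IsOpen s) (hΦ : ContDiffOn ℝ ∞ Φ s) {x₀ : E} (hx₀ : x₀ ∈ s) {Φ' : E →L[ℝ] F}
    (hΦ' : HasFDerivAt Φ Φ' x₀) (hFred : Φ'.IsFredholm) :
    ∃ U ∈ 𝓝 x₀, IsNowhereDense (Φ '' (U ∩ criticalPoints Φ)) := by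
  obtain ⟨π, hπ⟩ := hFred.closedComplemented_range
  have hπΦ' (v : E) : (π ∘L Φ') v = ⟨Φ' v, v, rfl⟩ := hπ ⟨Φ' v, v, rfl⟩
  have hsurj : Surjective (π ∘L Φ') := by
    rintro ⟨_, v, rfl⟩
    exact ⟨v, hπΦ' v⟩
  have hker : (π ∘L Φ').ker = Φ'.ker := by
    ext v
    rw [LinearMap.mem_ker, LinearMap.mem_ker, ContinuousLinearMap.coe_coe, hπΦ']
    exact Subtype.ext_iff
  have : CompleteSpace Φ'.range := hFred.isClosed_range.completeSpace_coe
  have : FiniteDimensional ℝ (π ∘L Φ').ker := hker ▸ hFred.finite_ker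
  have : FiniteDimensional ℝ (F ⧸ Φ'.range) := hFred.finite_coker
  have : FiniteDimensional ℝ π.ker :=
    (Submodule.quotientEquivOfIsCompl _ _ (LinearMap.isCompl_of_proj hπ)).finiteDimensional
  exact exists_nhds_isNowhereDense_image_criticalPoints_of_surjective hs hΦ hx₀ hΦ' hsurj
    hasMeagreCriticalValues

end Fredholm

section Manifold

variable {E F : Type*} [NormedAddCommGroup E] [NormedSpace ℝ E]
  [NormedAddCommGroup F] [NormedSpace ℝ F]
  {X Y : Type*} [TopologicalSpace X] [ChartedSpace E X] [TopologicalSpace Y] [ChartedSpace F Y]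

variable (E F) in
/-- The critical points of a map between manifolds modelled on `E` and `F`: the points where its
differential is not surjective. -/
def mcriticalPoints (Φ : X → Y) : Set X :=
  {x | ¬ Surjective (mfderiv 𝓘(ℝ, E) 𝓘(ℝ, F) Φ x)}

theorem compl_image_mcriticalPoints_subset_regularValues (Φ : X → Y) :
    (Φ '' mcriticalPoints E F Φ)ᶜ ⊆ regularValues E F Φ := by
  rintro _ hy x rfl
  exact not_not.1 fun hx ↦ hy ⟨x, hx, rfl⟩

theorem mem_criticalPoints_writtenInExtChartAt [IsManifold 𝓘(ℝ, E) 1 X] [IsManifold 𝓘(ℝ, F) 1 Y]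
    {Φ : X → Y} (hΦ : MDifferentiable 𝓘(ℝ, E) 𝓘(ℝ, F) Φ) {x₀ x : X}
    (hx : x ∈ (chartAt E x₀).source) (hy : Φ x ∈ (chartAt F (Φ x₀)).source)
    (hcrit : x ∈ mcriticalPoints E F Φ) :
    chartAt E x₀ x ∈ criticalPoints (writtenInExtChartAt 𝓘(ℝ, E) 𝓘(ℝ, F) x₀ Φ) := by
  have hz := (chartAt E x₀).map_source hx
  rw [← (chartAt E x₀).left_inv hx] at hy hcrit
  have hX := mdifferentiable_chart (I := 𝓘(ℝ, E)) x₀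
  have hY := mdifferentiable_chart (I := 𝓘(ℝ, F)) (Φ x₀)
  suffices ¬ Surjective (mfderiv 𝓘(ℝ, E) 𝓘(ℝ, F)
      (chartAt F (Φ x₀) ∘ Φ ∘ (chartAt E x₀).symm) (chartAt E x₀ x)) by
    rwa [mfderiv_eq_fderiv] at this
  rw [((hY.mdifferentiableAt hy).hasMFDerivAt.comp (chartAt E x₀ x) ((hΦ _).hasMFDerivAt.comp
    (chartAt E x₀ x) (hX.mdifferentiableAt_symm hz).hasMFDerivAt)).mfderiv,
    ContinuousLinearMap.coe_comp, ContinuousLinearMap.coe_comp]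
  exact fun hsurj ↦ hcrit (.of_comp (hsurj.of_comp_left (hY.mfderiv_injective hy)))

theorem IsSmoothFredholmMap.exists_nhds_isNowhereDense_image_mcriticalPoints [CompleteSpace E]
    [CompleteSpace F] [IsManifold 𝓘(ℝ, E) ∞ X] [IsManifold 𝓘(ℝ, F) ∞ Y] {Φ : X → Y}
    (hΦ : IsSmoothFredholmMap E F Φ) (x₀ : X) :
    ∃ U ∈ 𝓝 x₀, IsNowhereDense (Φ '' (U ∩ mcriticalPoints E F Φ)) := by
  have : IsManifold 𝓘(ℝ, E) 1 X := .of_le (n := ∞) (by simp)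
  have : IsManifold 𝓘(ℝ, F) 1 Y := .of_le (n := ∞) (by simp)
  let φ := chartAt E x₀
  let ψ := chartAt F (Φ x₀)
  have hdiff : MDifferentiable 𝓘(ℝ, E) 𝓘(ℝ, F) Φ := hΦ.contMDiff.mdifferentiable (by simp)
  have hopen : IsOpen (Φ ⁻¹' ψ.source) := ψ.open_source.preimage hΦ.contMDiff.continuous
  have hx₀ : x₀ ∈ φ.source ∩ Φ ⁻¹' ψ.source := ⟨mem_chart_source E x₀, mem_chart_source F (Φ x₀)⟩
  have hsmooth : ContDiffOn ℝ ∞ (writtenInExtChartAt 𝓘(ℝ, E) 𝓘(ℝ, F) x₀ Φ)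
      (φ.target ∩ φ.symm ⁻¹' (Φ ⁻¹' ψ.source)) := by
    simpa [φ, ψ, writtenInExtChartAt] using (contMDiff_iff.1 hΦ.contMDiff).2 x₀ (Φ x₀)
  have hderiv : HasFDerivAt (writtenInExtChartAt 𝓘(ℝ, E) 𝓘(ℝ, F) x₀ Φ)
      (mfderiv 𝓘(ℝ, E) 𝓘(ℝ, F) Φ x₀ : E →L[ℝ] F) (φ x₀) :=
    (hdiff x₀).hasMFDerivAt.2.hasFDerivAt (by simp)
  obtain ⟨U, hU, hd⟩ := exists_nhds_isNowhereDense_image_criticalPoints_of_isFredholm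
    (φ.isOpen_inter_preimage_symm hopen) hsmooth
    ⟨φ.map_source hx₀.1, by simpa [φ.left_inv hx₀.1] using hx₀.2⟩ hderiv
    (hΦ.isFredholm_mfderiv x₀)
  refine ⟨φ.source ∩ Φ ⁻¹' ψ.source ∩ φ ⁻¹' U, inter_mem
    ((φ.open_source.inter hopen).mem_nhds hx₀) ((φ.continuousAt hx₀.1).preimage_mem_nhds hU),
    (isNowhereDense_source_inter_preimage ψ hd).mono ?_⟩
  rintro _ ⟨x, ⟨⟨hx, hxU⟩, hcrit⟩, rfl⟩
  refine ⟨hx.2, φ x, ⟨hxU, mem_criticalPoints_writtenInExtChartAt hdiff hx.1 hx.2 hcrit⟩, ?_⟩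
  exact congrArg (ψ ∘ Φ) (φ.left_inv hx.1)

end Manifold

theorem mainTheorem3 {E F : Type*}
    [NormedAddCommGroup E] [NormedSpace ℝ E] [CompleteSpace E]
    [NormedAddCommGroup F] [NormedSpace ℝ F] [CompleteSpace F]
    {X Y : Type*}
    [TopologicalSpace X] [ChartedSpace E X] [IsManifold 𝓘(ℝ, E) ∞ X]
    [TopologicalSpace Y] [ChartedSpace F Y] [IsManifold 𝓘(ℝ, F) ∞ Y]
    (Φ : X → Y) (hFredholm : IsSmoothFredholmMap E F Φ) (hParaproper : IsParaproper Φ) :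
    regularValues E F Φ ∈ residual Y := by
  obtain ⟨K, hK, hKm⟩ := hParaproper.exists_exhaustion
  have hmeagre : IsMeagre (Φ '' mcriticalPoints E F Φ) := isMeagre_image_of_iUnion_eq_univ hK
    (fun m ↦ (hKm m).2) hFredholm.exists_nhds_isNowhereDense_image_mcriticalPoints
  exact mem_of_superset hmeagre (compl_image_mcriticalPoints_subset_regularValues Φ)
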